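/- Let $p\ge 1$ be an integer, let $\mu>0$ and $a<b$ be real numbers, put $\Omega=(a,b)$ and $\mathcal F(s)=-s(1+p\,s^{p})$. Let $(\cdot,\cdot)$ be the inner product of $L^2(\Omega)$, let $\nabla=\partial/\partial x$, and let $H_0^1(\Omega)=\{v\in H^1(\Omega): v=0 \text{ on } \partial\Omega\}$ with the norm $\|v\|_1^2=\|v\|^2+\|\nabla v\|^2$. For every $u_0\in H_0^1(\Omega)$ and every $T>0$ there is exactly one $u\in L^\infty(0,T;H_0^1(\Omega))$ which solves the weak problem of the generalized regularized long wave equation $u_t+u_x+p(p+1)u^pu_x-\mu u_{xxt}=0$ with initial value $u_0$, that is: $u$ has a weak time derivative $u_t\in L^1(0,T;H_0^1(\Omega))$ such that, for almost every $t\in(0,T)$, $$(u_t(t),\xi)+\mu\,(\nabla u_t(t),\nabla\xi)=-(\mathcal F(u(t)),\nabla\xi)\qquad\text{for all }\xi\in H_0^1(\Omega),$$ and $(u(0),\xi)=(u_0,\xi)$ for all $\xi\in H_0^1(\Omega)$, where $u(0)$ is the value at $t=0$ of the representative of $u$ that is continuous from $[0,T]$ to $H_0^1(\Omega)$. -/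

import Mathlib

open MeasureTheory Set
open scoped ContDiff ENNReal

namespace GRLW

/-- Test functions on the open interval `(c, d)`: the space `C_c^∞((c, d))`. -/
structure IsTestFunction (c d : ℝ) (φ : ℝ → ℝ) : Prop where
  smooth : ContDiff ℝ ∞ φ
  hasCompactSupport : HasCompactSupport φ
  support_subset : tsupport φ ⊆ Ioo c d

/-- `g` is the weak derivative of `f` on `(c, d)`. It is used below only for functions that are
integrable on `(c, d)`, with `E = ℝ` for the derivative in space and with the Hilbert space
`E = H_0^1` (and Bochner integrals) for the derivative in time. -/
def IsWeakDeriv {E : Type*} [NormedAddCommGroup E] [NormedSpace ℝ E]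
    (c d : ℝ) (f g : ℝ → E) : Prop :=
  ∀ φ : ℝ → ℝ, IsTestFunction c d φ →
    ∫ x in Ioo c d, deriv φ x • f x = -∫ x in Ioo c d, φ x • g x

/-- The space `L^2(a, b)` of real-valued functions. -/
abbrev L2 (a b : ℝ) : Type := Lp ℝ 2 (volume.restrict (Ioo a b))

theorem IsTestFunction.integrable_smul {c d : ℝ} {φ : ℝ → ℝ} (hφ : IsTestFunction c d φ)
    (f : L2 c d) : Integrable (fun x => φ x • f x) (volume.restrict (Ioo c d)) := by
  have hf : Integrable f (volume.restrict (Ioo c d)) :=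
    (Lp.memLp f).integrable (by norm_num)
  obtain ⟨C, hC⟩ := hφ.hasCompactSupport.exists_bound_of_continuous hφ.smooth.continuous
  exact hf.bdd_smul C hφ.smooth.continuous.aestronglyMeasurable
    (Filter.Eventually.of_forall hC)

theorem IsTestFunction.integrable_deriv_smul {c d : ℝ} {φ : ℝ → ℝ} (hφ : IsTestFunction c d φ)
    (f : L2 c d) : Integrable (fun x => deriv φ x • f x) (volume.restrict (Ioo c d)) := by
  have hf : Integrable f (volume.restrict (Ioo c d)) :=
    (Lp.memLp f).integrable (by norm_num)
  have hc : Continuous (deriv φ) := hφ.smooth.continuous_deriv (by simp)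
  obtain ⟨C, hC⟩ := hφ.hasCompactSupport.deriv.exists_bound_of_continuous hc
  exact hf.bdd_smul C hc.aestronglyMeasurable (Filter.Eventually.of_forall hC)

/-- The Sobolev space `H^1(a, b)`, each function `v` being stored together with its weak
derivative as the pair `(v, Dv)` in the Hilbert sum `L^2 ⊕ L^2`. The inherited norm is the usual
one, `‖v‖_1 ^ 2 = ‖v‖ ^ 2 + ‖Dv‖ ^ 2`. -/
def H1 (a b : ℝ) : Submodule ℝ (WithLp 2 (L2 a b × L2 a b)) where
  carrier := {v | IsWeakDeriv a b v.fst v.snd}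
  zero_mem' := by
    intro φ _
    have h0 : ((0 : L2 a b) : ℝ → ℝ) =ᵐ[volume.restrict (Ioo a b)] 0 := Lp.coeFn_zero _ _ _
    have h1 : ∀ ψ : ℝ → ℝ, ∫ x in Ioo a b, ψ x • (0 : L2 a b) x = 0 := by
      intro ψ
      rw [integral_congr_ae (g := fun _ => (0 : ℝ))]
      · simp
      · filter_upwards [h0] with x hx
        rw [hx, Pi.zero_apply, smul_zero]
    change ∫ x in Ioo a b, deriv φ x • (0 : L2 a b) x = -∫ x in Ioo a b, φ x • (0 : L2 a b) x
    rw [h1, h1, neg_zero]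
  add_mem' := by
    intro v w hv hw φ hφ
    have h1 : ∫ x in Ioo a b, deriv φ x • (v.fst + w.fst) x
        = (∫ x in Ioo a b, deriv φ x • v.fst x) + ∫ x in Ioo a b, deriv φ x • w.fst x := by
      rw [← integral_add (hφ.integrable_deriv_smul _) (hφ.integrable_deriv_smul _)]
      refine integral_congr_ae ?_
      filter_upwards [Lp.coeFn_add v.fst w.fst] with x hx
      rw [hx, Pi.add_apply, smul_add]
    have h2 : ∫ x in Ioo a b, φ x • (v.snd + w.snd) x
        = (∫ x in Ioo a b, φ x • v.snd x) + ∫ x in Ioo a b, φ x • w.snd x := by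
      rw [← integral_add (hφ.integrable_smul _) (hφ.integrable_smul _)]
      refine integral_congr_ae ?_
      filter_upwards [Lp.coeFn_add v.snd w.snd] with x hx
      rw [hx, Pi.add_apply, smul_add]
    change ∫ x in Ioo a b, deriv φ x • (v.fst + w.fst) x
      = -∫ x in Ioo a b, φ x • (v.snd + w.snd) x
    rw [h1, h2, hv φ hφ, hw φ hφ]
    ring
  smul_mem' := by
    intro r v hv φ hφ
    have h : ∀ (ψ : ℝ → ℝ) (f : L2 a b), ∫ x in Ioo a b, ψ x • (r • f) x
        = r * ∫ x in Ioo a b, ψ x • f x := by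
      intro ψ f
      rw [← integral_const_mul]
      refine integral_congr_ae ?_
      filter_upwards [Lp.coeFn_smul r f] with x hx
      simp only [hx, Pi.smul_apply, smul_eq_mul]
      ring
    change ∫ x in Ioo a b, deriv φ x • (r • v.fst) x = -∫ x in Ioo a b, φ x • (r • v.snd) x
    rw [h, h, hv φ hφ]
    ring

/-- `f = 0` on the boundary `{a, b}` of `(a, b)`, in the sense of traces: `f` has a
representative that is continuous on `[a, b]` and vanishes at `a` and at `b`. -/
def VanishesOnBoundary (a b : ℝ) (f : L2 a b) : Prop :=
  ∃ w : ℝ → ℝ, ContinuousOn w (Icc a b) ∧ f =ᵐ[volume.restrict (Ioo a b)] w ∧ w a = 0 ∧ w b = 0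

/-- The Sobolev space `H_0^1(a, b) = {v ∈ H^1(a, b) : v = 0 on ∂(a, b)}`, with the `H^1` norm. -/
def H10 (a b : ℝ) : Submodule ℝ (WithLp 2 (L2 a b × L2 a b)) where
  carrier := {v | v ∈ H1 a b ∧ VanishesOnBoundary a b v.fst}
  zero_mem' := ⟨(H1 a b).zero_mem, 0, continuousOn_const, Lp.coeFn_zero _ _ _, rfl, rfl⟩
  add_mem' := by
    rintro v w ⟨hv, f, hf, hvf, hfa, hfb⟩ ⟨hw, g, hg, hwg, hga, hgb⟩
    refine ⟨(H1 a b).add_mem hv hw, f + g, hf.add hg, ?_, by simp [hfa, hga], by simp [hfb, hgb]⟩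
    exact (Lp.coeFn_add v.fst w.fst).trans (hvf.add hwg)
  smul_mem' := by
    rintro r v ⟨hv, f, hf, hvf, hfa, hfb⟩
    refine ⟨(H1 a b).smul_mem r hv, r • f, hf.const_smul r, ?_, by simp [hfa], by simp [hfb]⟩
    exact (Lp.coeFn_smul r v.fst).trans (hvf.const_smul r)

/-- The function in `L^2(a, b)` underlying an element of `H_0^1(a, b)`. -/
def toL2 {a b : ℝ} (v : H10 a b) : L2 a b := (v : WithLp 2 (L2 a b × L2 a b)).fst

/-- The (weak) derivative `∇v = Dv` in `L^2(a, b)` of an element `v` of `H_0^1(a, b)`. -/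
def grad {a b : ℝ} (v : H10 a b) : L2 a b := (v : WithLp 2 (L2 a b × L2 a b)).snd

/-- The nonlinearity `F(s) = -s (1 + p s ^ p)`. -/
def flux (p : ℕ) (s : ℝ) : ℝ := -(s * (1 + p * s ^ p))

/-- The space `L^∞(0, T; H_0^1(a, b))`. -/
abbrev LinftyH10 (a b T : ℝ) : Type := Lp (H10 a b) ∞ (volume.restrict (Ioo 0 T))

/-- `u ∈ L^∞(0, T; H_0^1(a, b))` solves the weak problem: it has a weak time derivative
`u_t ∈ L^1(0, T; H_0^1(a, b))`, for almost every `t` in `(0, T)`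
`(u_t, ξ) + μ (∇u_t, ∇ξ) = -(F(u), ∇ξ)` for all `ξ ∈ H_0^1(a, b)`, and `(u(0), ξ) = (u₀, ξ)` for
all `ξ ∈ H_0^1(a, b)`, where `u(0)` is the value at `0` of the representative of `u` that is
continuous on `[0, T]`. -/
structure IsWeakSolution (p : ℕ) (μ a b T : ℝ) (u₀ : H10 a b) (u : LinftyH10 a b T) : Prop where
  equation : ∃ ut : ℝ → H10 a b,
    Integrable ut (volume.restrict (Ioo 0 T)) ∧ IsWeakDeriv 0 T u ut ∧
    ∀ᵐ t ∂(volume.restrict (Ioo 0 T)), ∀ ξ : H10 a b,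
      inner ℝ (toL2 (ut t)) (toL2 ξ) + μ * inner ℝ (grad (ut t)) (grad ξ)
        = -∫ x in Ioo a b, flux p (toL2 (u t) x) * grad ξ x
  initial : ∃ w : ℝ → H10 a b,
    ContinuousOn w (Icc 0 T) ∧ u =ᵐ[volume.restrict (Ioo 0 T)] w ∧
    ∀ ξ : H10 a b, inner ℝ (toL2 (w 0)) (toL2 ξ) = inner ℝ (toL2 u₀) (toL2 ξ)

end GRLW

/-! The term `-μ u_xxt` turns the equation into an ordinary differential equation in `H10`. The form
`(v, w) + μ (∇v, ∇w)` is coercive there, so Lax–Milgram solves the weak problem for `u_t` and gives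
`u_t = G(u)` with `G` mapping `H10` to itself. In one dimension `H10` embeds into the bounded
functions, so cutting the flux off at a height `M` changes nothing on a given ball and makes the
field bounded and globally Lipschitz (`exists_field_flux`). Picard–Lindelöf then gives an integral
curve on all of `[0, T]`.

The cutoff does no harm because of conservation of energy. Testing with `u` itself, the right-hand
side is the integral of the exact derivative of `P(u)`, where `P` is an antiderivative of the flux,
and `u` vanishes at both ends (`integral_comp_mul_grad_eq_zero`). This also holds for the cut-off
flux, so the energy `‖u‖² + μ‖∇u‖²` is constant and the ball can be fixed in advance from `u₀`.

For uniqueness, du Bois-Reymond makes any weak solution a primitive of its weak derivative, so its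
continuous representative is a classical integral curve (`IsWeakSolution.exists_representative`).
Two such curves with the same initial value agree by uniqueness for Lipschitz fields. -/

namespace GRLW

/-! ### Weak derivatives and primitives on an interval -/

section Calculus

variable {E : Type*} [NormedAddCommGroup E] [NormedSpace ℝ E] {c d : ℝ}

/-- Integration by parts of a `C^1` function against the primitive of an integrable function. -/
theorem integral_deriv_mul_primitive {ψ g : ℝ → ℝ} (hψ : ContDiff ℝ 1 ψ)
    (hg : IntervalIntegrable g volume c d) :
    ∫ x in c..d, deriv ψ x * ∫ t in c..x, g t
      = ψ d * (∫ t in c..d, g t) - ∫ x in c..d, ψ x * g x := by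
  have h1 : AbsolutelyContinuousOnInterval ψ c d :=
    hψ.contDiffOn.absolutelyContinuousOnInterval
  have h2 : AbsolutelyContinuousOnInterval (fun x => ∫ t in c..x, g t) c d :=
    hg.absolutelyContinuousOnInterval_intervalIntegral left_mem_uIcc
  have h3 := h1.integral_mul_deriv_eq_deriv_mul h2
  have h4 : ∫ x in c..d, ψ x * deriv (fun x => ∫ t in c..x, g t) x = ∫ x in c..d, ψ x * g x := by
    refine intervalIntegral.integral_congr_ae ?_
    filter_upwards [hg.ae_hasDerivAt_integral] with x hx hxm
    rw [(hx (uIoc_subset_uIcc hxm) c left_mem_uIcc).deriv]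
  rw [h4] at h3
  simp only [intervalIntegral.integral_same, mul_zero, sub_zero] at h3
  linarith

/-- Continuous linear functionals separate the points of `E` and commute with the integrals, which
reduces the claim to real-valued `g`. -/
theorem integral_deriv_smul_primitive [CompleteSpace E] {ψ : ℝ → ℝ} {g : ℝ → E} (hψ : ContDiff ℝ 1 ψ)
    (hg : IntervalIntegrable g volume c d) :
    ∫ x in c..d, deriv ψ x • ∫ t in c..x, g t
      = ψ d • (∫ t in c..d, g t) - ∫ x in c..d, ψ x • g x := by
  have hψ' : Continuous (deriv ψ) := hψ.continuous_deriv le_rfl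
  have hG : ContinuousOn (fun x => ∫ t in c..x, g t) (uIcc c d) :=
    intervalIntegral.continuousOn_primitive_interval' hg left_mem_uIcc
  have i1 : IntervalIntegrable (fun x => deriv ψ x • ∫ t in c..x, g t) volume c d :=
    (hψ'.continuousOn.smul hG).intervalIntegrable
  have i2 : IntervalIntegrable (fun x => ψ x • g x) volume c d :=
    hg.continuousOn_smul hψ.continuous.continuousOn
  refine (SeparatingDual.eq_iff_forall_dual_eq (R := ℝ)).2 fun ℓ => ?_
  have hgl : IntervalIntegrable (fun x => ℓ (g x)) volume c d :=
    ⟨ℓ.integrable_comp hg.1, ℓ.integrable_comp hg.2⟩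
  rw [map_sub, map_smul, ← ℓ.intervalIntegral_comp_comm i1, ← ℓ.intervalIntegral_comp_comm hg,
    ← ℓ.intervalIntegral_comp_comm i2]
  simp only [map_smul, smul_eq_mul]
  rw [← integral_deriv_mul_primitive hψ hgl]
  refine intervalIntegral.integral_congr fun x hx => ?_
  have hgx : IntervalIntegrable g volume c x := hg.mono_set (uIcc_subset_uIcc_left hx)
  simp only [ℓ.intervalIntegral_comp_comm hgx]

theorem setIntegral_Ioo_eq_intervalIntegral (hcd : c ≤ d) (f : ℝ → E) :
    ∫ x in Ioo c d, f x = ∫ x in c..d, f x := by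
  rw [intervalIntegral.integral_of_le hcd, integral_Ioc_eq_integral_Ioo]

theorem intervalIntegrable_of_integrable_Ioo {F : Type*} [NormedAddCommGroup F]
    (hcd : c ≤ d) {f : ℝ → F}
    (hf : Integrable f (volume.restrict (Ioo c d))) : IntervalIntegrable f volume c d :=
  (intervalIntegrable_iff_integrableOn_Ioo_of_le hcd).2 hf

theorem IsTestFunction.eq_zero_of_notMem {φ : ℝ → ℝ} (hφ : IsTestFunction c d φ) {x : ℝ}
    (hx : x ∉ Ioo c d) : φ x = 0 :=
  image_eq_zero_of_notMem_tsupport fun h => hx (hφ.support_subset h)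

/-- Primitives of integrable functions have the expected weak derivative. -/
theorem isWeakDeriv_primitive [CompleteSpace E] (hcd : c ≤ d) {g : ℝ → E}
    (hg : Integrable g (volume.restrict (Ioo c d))) (C : E) :
    IsWeakDeriv c d (fun x => C + ∫ t in c..x, g t) g := by
  intro φ hφ
  have hg' := intervalIntegrable_of_integrable_Ioo hcd hg
  have hφ1 : ContDiff ℝ 1 φ := hφ.smooth.of_le (by simp)
  have hφ' : Continuous (deriv φ) := hφ1.continuous_deriv le_rfl
  have hG : ContinuousOn (fun x => ∫ t in c..x, g t) (uIcc c d) :=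
    intervalIntegral.continuousOn_primitive_interval' hg' left_mem_uIcc
  have hd : φ d = 0 := hφ.eq_zero_of_notMem (by simp)
  have hc : φ c = 0 := hφ.eq_zero_of_notMem (by simp)
  rw [setIntegral_Ioo_eq_intervalIntegral hcd, setIntegral_Ioo_eq_intervalIntegral hcd]
  simp only [smul_add]
  have i1 : IntervalIntegrable (fun x => deriv φ x • C) volume c d :=
    (hφ'.smul continuous_const).intervalIntegrable _ _
  have i2 : IntervalIntegrable (fun x => deriv φ x • ∫ t in c..x, g t) volume c d :=
    (hφ'.continuousOn.smul hG).intervalIntegrable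
  rw [intervalIntegral.integral_add i1 i2, integral_deriv_smul_primitive hφ1 hg',
    intervalIntegral.integral_smul_const, intervalIntegral.integral_deriv_eq_sub
      (fun x _ => (hφ1.differentiable one_ne_zero) x) (hφ'.intervalIntegrable _ _)]
  simp [hc, hd]

/-- A compactly supported smooth function on `(c, d)` with vanishing integral is the derivative of
a test function. -/
theorem exists_isTestFunction_deriv_eq (hcd : c < d) {ψ : ℝ → ℝ} (hψ : IsTestFunction c d ψ)
    (h0 : ∫ x in c..d, ψ x = 0) : ∃ φ, IsTestFunction c d φ ∧ deriv φ = ψ := by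
  obtain ⟨c', d', hc', hd', hs⟩ : ∃ c' d', c < c' ∧ d' < d ∧ tsupport ψ ⊆ Icc c' d' := by
    rcases (tsupport ψ).eq_empty_or_nonempty with he | hne
    -- For `ψ = 0` the choice `c' = d`, `d' = c` makes `Icc c' d'` empty.
    · exact ⟨d, c, hcd, hcd, by simp [he]⟩
    · have hK : IsCompact (tsupport ψ) := hψ.hasCompactSupport
      exact ⟨sInf (tsupport ψ), sSup (tsupport ψ),
        (hψ.support_subset (hK.sInf_mem hne)).1, (hψ.support_subset (hK.sSup_mem hne)).2,
        fun x hx => ⟨csInf_le hK.bddBelow hx, le_csSup hK.bddAbove hx⟩⟩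
  have hψ0 : ∀ x, x ∉ Icc c' d' → ψ x = 0 := fun x hx =>
    image_eq_zero_of_notMem_tsupport fun h => hx (hs h)
  have hψc : Continuous ψ := hψ.smooth.continuous
  have hderiv : ∀ x, HasDerivAt (fun x => ∫ t in c..x, ψ t) (ψ x) x := fun x =>
    intervalIntegral.integral_hasDerivAt_right (hψc.intervalIntegrable _ _)
      (hψc.stronglyMeasurableAtFilter _ _) hψc.continuousAt
  have hd : deriv (fun x => ∫ t in c..x, ψ t) = ψ := funext fun x => (hderiv x).deriv
  -- The primitive vanishes on the left because `ψ` does, and on the right because the total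
  -- integral of `ψ` is zero.
  have hz : ∀ x, x ∉ Icc c' d' → ∫ t in c..x, ψ t = 0 := by
    intro x hx
    rw [mem_Icc, not_and_or, not_le, not_le] at hx
    rcases hx with hx | hx
    · refine intervalIntegral.integral_zero_ae (ae_of_all _ fun t ht => hψ0 t fun h => ?_)
      have := (mem_uIoc.1 ht)
      rcases this with h' | h' <;> linarith [h.1, h.2, h'.1, h'.2]
    · rw [← intervalIntegral.integral_add_adjacent_intervals (b := d)
        (hψc.intervalIntegrable _ _) (hψc.intervalIntegrable _ _), h0, zero_add]
      refine intervalIntegral.integral_zero_ae (ae_of_all _ fun t ht => hψ0 t fun h => ?_)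
      have := (mem_uIoc.1 ht)
      rcases this with h' | h' <;> linarith [h.1, h.2, h'.1, h'.2]
  have hts : tsupport (fun x => ∫ t in c..x, ψ t) ⊆ Icc c' d' :=
    closure_minimal (fun x hx => by_contra fun h => hx (hz x h)) isClosed_Icc
  refine ⟨fun x => ∫ t in c..x, ψ t, ⟨?_, ?_, ?_⟩, hd⟩
  · rw [contDiff_infty_iff_deriv]
    exact ⟨fun x => (hderiv x).differentiableAt, by rw [hd]; exact hψ.smooth⟩
  · exact HasCompactSupport.of_support_subset_isCompact isCompact_Icc
      (subset_closure.trans hts)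
  · exact hts.trans fun x hx => ⟨hc'.trans_le hx.1, hx.2.trans_lt hd'⟩

theorem IsTestFunction.sub_smul {φ ψ : ℝ → ℝ} (hφ : IsTestFunction c d φ)
    (hψ : IsTestFunction c d ψ) (r : ℝ) : IsTestFunction c d (fun x => φ x - r * ψ x) := by
  have hK : IsCompact (tsupport φ ∪ tsupport ψ) :=
    hφ.hasCompactSupport.isCompact.union hψ.hasCompactSupport.isCompact
  have hts : tsupport (fun x => φ x - r * ψ x) ⊆ tsupport φ ∪ tsupport ψ := by
    refine closure_minimal (fun x hx => by_contra fun h => hx ?_) hK.isClosed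
    rw [mem_union, not_or] at h
    simp [image_eq_zero_of_notMem_tsupport h.1, image_eq_zero_of_notMem_tsupport h.2]
  exact ⟨hφ.smooth.sub (contDiff_const.mul hψ.smooth),
    HasCompactSupport.of_support_subset_isCompact hK (subset_closure.trans hts),
    hts.trans (union_subset hφ.support_subset hψ.support_subset)⟩

theorem exists_isTestFunction_integral_eq_one (hcd : c < d) :
    ∃ η, IsTestFunction c d η ∧ ∫ x in c..d, η x = 1 := by
  let η : ContDiffBump ((c + d) / 2) := ⟨(d - c) / 8, (d - c) / 4, by linarith, by linarith⟩
  have hs : tsupport (η.normed volume) ⊆ Ioo c d := by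
    rw [η.tsupport_normed_eq, Real.closedBall_eq_Icc]
    intro x hx
    have h1 := hx.1
    have h2 := hx.2
    simp only [η] at h1 h2
    constructor <;> linarith
  refine ⟨η.normed volume, ⟨η.contDiff_normed, η.hasCompactSupport_normed, hs⟩, ?_⟩
  rw [← η.integral_normed (μ := volume), ← setIntegral_Ioo_eq_intervalIntegral hcd.le]
  exact setIntegral_eq_integral_of_forall_compl_eq_zero fun x hx =>
    image_eq_zero_of_notMem_tsupport fun h => hx (hs h)

theorem IsTestFunction.integrable_smul_of_integrable {φ : ℝ → ℝ} (hφ : IsTestFunction c d φ)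
    {f : ℝ → E} (hf : Integrable f (volume.restrict (Ioo c d))) :
    Integrable (fun x => φ x • f x) (volume.restrict (Ioo c d)) := by
  obtain ⟨C, hC⟩ := hφ.hasCompactSupport.exists_bound_of_continuous hφ.smooth.continuous
  exact hf.bdd_smul C hφ.smooth.continuous.aestronglyMeasurable (Filter.Eventually.of_forall hC)

theorem IsTestFunction.integrable_deriv_smul_of_integrable {φ : ℝ → ℝ}
    (hφ : IsTestFunction c d φ) {f : ℝ → E} (hf : Integrable f (volume.restrict (Ioo c d))) :
    Integrable (fun x => deriv φ x • f x) (volume.restrict (Ioo c d)) := by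
  have hc : Continuous (deriv φ) := hφ.smooth.continuous_deriv (by simp)
  obtain ⟨C, hC⟩ := hφ.hasCompactSupport.deriv.exists_bound_of_continuous hc
  exact hf.bdd_smul C hc.aestronglyMeasurable (Filter.Eventually.of_forall hC)

/-- The fundamental lemma of the calculus of variations on an interval. -/
theorem ae_eq_zero_of_forall_isTestFunction [CompleteSpace E] {h : ℝ → E}
    (hh : Integrable h (volume.restrict (Ioo c d)))
    (h0 : ∀ φ, IsTestFunction c d φ → ∫ x in Ioo c d, φ x • h x = 0) :
    h =ᵐ[volume.restrict (Ioo c d)] 0 := by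
  have := isOpen_Ioo.ae_eq_zero_of_integral_contDiff_smul_eq_zero (μ := volume) (U := Ioo c d)
    (f := h) (IntegrableOn.locallyIntegrableOn hh) (fun φ h1 h2 h3 => by
      rw [← h0 φ ⟨h1, h2, h3⟩]
      refine (setIntegral_eq_integral_of_forall_compl_eq_zero fun x hx => ?_).symm
      rw [image_eq_zero_of_notMem_tsupport fun h => hx (h3 h), zero_smul])
  exact (ae_restrict_iff' measurableSet_Ioo).2 this

/-- **Du Bois-Reymond**: a function with vanishing weak derivative is constant. -/
theorem exists_ae_eq_const_of_isWeakDeriv_zero [CompleteSpace E] (hcd : c < d)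
    {h : ℝ → E}
    (hh : Integrable h (volume.restrict (Ioo c d)))
    (h0 : ∀ φ, IsTestFunction c d φ → ∫ x in Ioo c d, deriv φ x • h x = 0) :
    ∃ C, h =ᵐ[volume.restrict (Ioo c d)] fun _ => C := by
  obtain ⟨η, hη, hη1⟩ := exists_isTestFunction_integral_eq_one hcd
  -- The constant is the mean of `h` with weight `η`.
  refine ⟨∫ x in Ioo c d, η x • h x, ?_⟩
  have hconst : Integrable (fun _ : ℝ => ∫ x in Ioo c d, η x • h x)
      (volume.restrict (Ioo c d)) := integrable_const _
  have key := ae_eq_zero_of_forall_isTestFunction (hh.sub hconst) (fun ψ hψ => ?_)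
  · filter_upwards [key] with x hx
    simpa [sub_eq_zero] using hx
  -- Subtracting `(∫ ψ) η` gives `ψ` mean zero, hence makes it an admissible `deriv φ`; the
  -- hypothesis then reads `∫ ψ h = (∫ ψ) (∫ η h)`.
  obtain ⟨φ, hφ, hφ'⟩ := exists_isTestFunction_deriv_eq hcd
    (hψ.sub_smul hη (∫ x in c..d, ψ x)) (by
      rw [intervalIntegral.integral_sub (hψ.smooth.continuous.intervalIntegrable _ _)
        ((hη.smooth.continuous.intervalIntegrable _ _).const_mul _),
        intervalIntegral.integral_const_mul, hη1, mul_one, sub_self])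
  have h1 := h0 φ hφ
  simp only [hφ', sub_smul, mul_smul] at h1
  have hηh : Integrable (fun x => (∫ x in c..d, ψ x) • η x • h x) (volume.restrict (Ioo c d)) :=
    (hη.integrable_smul_of_integrable hh).smul _
  rw [integral_sub (hψ.integrable_smul_of_integrable hh) hηh, integral_smul] at h1
  simp only [Pi.sub_apply, smul_sub]
  rw [integral_sub (hψ.integrable_smul_of_integrable hh)
    (hψ.integrable_smul_of_integrable hconst), integral_smul_const,
    setIntegral_Ioo_eq_intervalIntegral hcd.le ψ, h1]

/-- An integrable function with integrable weak derivative is a primitive of it. -/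
theorem IsWeakDeriv.exists_ae_eq_add_primitive [CompleteSpace E] (hcd : c < d) {f g : ℝ → E}
    (h : IsWeakDeriv c d f g) (hf : Integrable f (volume.restrict (Ioo c d)))
    (hg : Integrable g (volume.restrict (Ioo c d))) :
    ∃ C, f =ᵐ[volume.restrict (Ioo c d)] fun x => C + ∫ t in c..x, g t := by
  have hg' := intervalIntegrable_of_integrable_Ioo hcd.le hg
  have hG : IntervalIntegrable (fun x => 0 + ∫ t in c..x, g t) volume c d :=
    (continuousOn_const.add (intervalIntegral.continuousOn_primitive_interval' hg'
      left_mem_uIcc)).intervalIntegrable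
  have hG' : Integrable (fun x => 0 + ∫ t in c..x, g t) (volume.restrict (Ioo c d)) :=
    (intervalIntegrable_iff_integrableOn_Ioo_of_le hcd.le).1 hG
  obtain ⟨C, hC⟩ := exists_ae_eq_const_of_isWeakDeriv_zero hcd (hf.sub hG') (fun φ hφ => by
    simp only [Pi.sub_apply, smul_sub]
    rw [integral_sub (hφ.integrable_deriv_smul_of_integrable hf)
      (hφ.integrable_deriv_smul_of_integrable hG'), h φ hφ,
      isWeakDeriv_primitive hcd.le hg 0 φ hφ, sub_self])
  refine ⟨C, ?_⟩
  filter_upwards [hC] with x hx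
  rw [← hx]
  simp

end Calculus

/-! ### The Hilbert space `H10` and its embedding into bounded functions -/

section Sobolev

variable {a b : ℝ}

theorem integrable_L2 (f : L2 a b) : Integrable f (volume.restrict (Ioo a b)) :=
  (Lp.memLp f).integrable (by norm_num)

theorem intervalIntegrable_L2 (hab : a ≤ b) (f : L2 a b) : IntervalIntegrable f volume a b :=
  intervalIntegrable_of_integrable_Ioo hab (integrable_L2 f)

/-- A function in `H_0^1` is the primitive of its weak derivative, and the latter has mean zero. -/
theorem ae_eq_primitive_of_mem_H10 (hab : a < b) {v : WithLp 2 (L2 a b × L2 a b)}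
    (hv : v ∈ H10 a b) :
    v.fst =ᵐ[volume.restrict (Ioo a b)] (fun x => ∫ t in a..x, v.snd t) ∧
      ∫ t in a..b, v.snd t = 0 := by
  obtain ⟨h1, w, hw, hvw, hwa, hwb⟩ := hv
  obtain ⟨C, hC⟩ := IsWeakDeriv.exists_ae_eq_add_primitive hab h1 (integrable_L2 _)
    (integrable_L2 _)
  have hG : ContinuousOn (fun x => ∫ t in a..x, v.snd t) (Icc a b) := by
    rw [← uIcc_of_le hab.le]
    exact intervalIntegral.continuousOn_primitive_interval' (intervalIntegrable_L2 hab.le _)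
      left_mem_uIcc
  have hG' : ContinuousOn (fun x => C + ∫ t in a..x, v.snd t) (Icc a b) :=
    continuousOn_const.add hG
  have hae : w =ᵐ[volume.restrict (Icc a b)] fun x => C + ∫ t in a..x, v.snd t := by
    rw [← restrict_Ioo_eq_restrict_Icc]
    exact hvw.symm.trans hC
  -- Continuous functions that agree almost everywhere agree at the endpoints too: the value at `a`
  -- gives `C = 0`, the value at `b` gives mean zero.
  have heq := Measure.eqOn_Icc_of_ae_eq volume hab.ne hae hw hG'
  have ha := heq (left_mem_Icc.2 hab.le)
  have hb := heq (right_mem_Icc.2 hab.le)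
  simp only [intervalIntegral.integral_same, add_zero] at ha
  rw [hwa] at ha
  subst ha
  refine ⟨?_, by simpa [hwb] using hb.symm⟩
  filter_upwards [hC] with x hx
  simpa using hx

/-- Functions in `H_0^1` are characterised by integration by parts against all smooth functions. -/
theorem mem_H10_iff_forall (hab : a < b) {v : WithLp 2 (L2 a b × L2 a b)} :
    v ∈ H10 a b ↔ ∀ ψ : ℝ → ℝ, ContDiff ℝ ∞ ψ →
      (∫ x in Ioo a b, deriv ψ x * v.fst x) + ∫ x in Ioo a b, ψ x * v.snd x = 0 := by
  have hg := intervalIntegrable_L2 hab.le v.snd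
  have hG : ContinuousOn (fun x => ∫ t in a..x, v.snd t) (uIcc a b) :=
    intervalIntegral.continuousOn_primitive_interval' hg left_mem_uIcc
  constructor
  · intro hv ψ hψ
    obtain ⟨h1, h2⟩ := ae_eq_primitive_of_mem_H10 hab hv
    have h3 : ∫ x in Ioo a b, deriv ψ x * v.fst x
        = ∫ x in Ioo a b, deriv ψ x * ∫ t in a..x, v.snd t := by
      refine integral_congr_ae ?_
      filter_upwards [h1] with x hx
      rw [hx]
    rw [h3, setIntegral_Ioo_eq_intervalIntegral hab.le, setIntegral_Ioo_eq_intervalIntegral hab.le,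
      integral_deriv_mul_primitive (hψ.of_le (by simp)) hg, h2]
    simp
  · intro h
    have h1 : IsWeakDeriv a b v.fst v.snd := fun φ hφ => by
      simpa [eq_neg_iff_add_eq_zero] using h φ hφ.smooth
    obtain ⟨C, hC⟩ := h1.exists_ae_eq_add_primitive hab (integrable_L2 _) (integrable_L2 _)
    have h2 : ∫ t in a..b, v.snd t = 0 := by
      -- The test function `1` yields the mean-zero condition; below, the test function `x` yields
      -- `C = 0`.
      have := h (fun _ => 1) contDiff_const
      rw [← setIntegral_Ioo_eq_intervalIntegral hab.le]
      simpa using this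
    have h3 : C = 0 := by
      have h4 := h (fun x => x) contDiff_id
      have h5 : ∫ x in Ioo a b, deriv (fun x : ℝ => x) x * v.fst x
          = (b - a) * C + ∫ x in a..b, deriv (fun x : ℝ => x) x * ∫ t in a..x, v.snd t := by
        rw [← smul_eq_mul (b - a) C, ← intervalIntegral.integral_const,
          ← intervalIntegral.integral_add (by simp)
            (by simpa using hG.intervalIntegrable), ← setIntegral_Ioo_eq_intervalIntegral hab.le]
        refine integral_congr_ae ?_
        filter_upwards [hC] with x hx
        rw [hx]
        simp
      have h7 := integral_deriv_mul_primitive (ψ := fun x : ℝ => x) contDiff_id hg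
      rw [h5, h7, h2,
        setIntegral_Ioo_eq_intervalIntegral hab.le] at h4
      have h6 : (b - a) * C = 0 := by linarith
      exact (mul_eq_zero.1 h6).resolve_left (sub_ne_zero.2 hab.ne')
    refine ⟨h1, fun x => ∫ t in a..x, v.snd t, by rwa [← uIcc_of_le hab.le], ?_, by simp, h2⟩
    filter_upwards [hC] with x hx
    simpa [h3] using hx

theorem continuous_integral_mul_L2 {ψ : ℝ → ℝ} (hψ : Continuous ψ) :
    Continuous fun f : L2 a b => ∫ x in Ioo a b, ψ x * f x := by
  obtain ⟨C, hC⟩ := isCompact_Icc.exists_bound_of_continuousOn (s := Icc a b) hψ.continuousOn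
  have hm : MemLp ψ 2 (volume.restrict (Ioo a b)) := by
    refine MemLp.of_bound hψ.aestronglyMeasurable C ?_
    filter_upwards [ae_restrict_mem measurableSet_Ioo] with x hx
    exact hC x (Ioo_subset_Icc_self hx)
  have h : (fun f : L2 a b => ∫ x in Ioo a b, ψ x * f x) = fun f => inner ℝ (hm.toLp ψ) f := by
    funext f
    rw [L2.inner_def]
    refine integral_congr_ae ?_
    filter_upwards [hm.coeFn_toLp] with x hx
    simp [hx, mul_comm]
  rw [h]
  fun_prop

/-- Integration by parts against all smooth `ψ` encodes the boundary condition by functionals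
continuous for the `L²` norms, so the space is an intersection of closed sets. -/
theorem isClosed_H10 (hab : a < b) :
    IsClosed (H10 a b : Set (WithLp 2 (L2 a b × L2 a b))) := by
  have : (H10 a b : Set (WithLp 2 (L2 a b × L2 a b))) = ⋂ (ψ : ℝ → ℝ) (_ : ContDiff ℝ ∞ ψ),
      {v | (∫ x in Ioo a b, deriv ψ x * v.fst x) + ∫ x in Ioo a b, ψ x * v.snd x = 0} := by
    ext v
    simp only [SetLike.mem_coe, mem_H10_iff_forall hab, mem_iInter, mem_ofPred_eq]
  rw [this]
  refine isClosed_iInter fun ψ => isClosed_iInter fun hψ => isClosed_eq ?_ continuous_const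
  have h1 : Continuous fun v : WithLp 2 (L2 a b × L2 a b) => v.fst :=
    (WithLp.prod_continuous_ofLp 2 _ _).fst
  have h2 : Continuous fun v : WithLp 2 (L2 a b × L2 a b) => v.snd :=
    (WithLp.prod_continuous_ofLp 2 _ _).snd
  exact ((continuous_integral_mul_L2 (hψ.continuous_deriv (by simp))).comp h1).add
    ((continuous_integral_mul_L2 hψ.continuous).comp h2)

theorem completeSpace_H10 (hab : a < b) : CompleteSpace (H10 a b) :=
  (isClosed_H10 hab).completeSpace_coe

theorem toL2_ae_eq_primitive (hab : a < b) (v : H10 a b) :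
    toL2 v =ᵐ[volume.restrict (Ioo a b)] fun x => ∫ t in a..x, grad v t :=
  (ae_eq_primitive_of_mem_H10 hab v.2).1

theorem integral_grad_eq_zero (hab : a < b) (v : H10 a b) : ∫ t in a..b, grad v t = 0 :=
  (ae_eq_primitive_of_mem_H10 hab v.2).2

theorem inner_H10 (v w : H10 a b) :
    inner ℝ v w = inner ℝ (toL2 v) (toL2 w) + inner ℝ (grad v) (grad w) :=
  WithLp.prod_inner_apply _ _

theorem norm_sq_H10 (v : H10 a b) : ‖v‖ ^ 2 = ‖toL2 v‖ ^ 2 + ‖grad v‖ ^ 2 := by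
  rw [← real_inner_self_eq_norm_sq, inner_H10, real_inner_self_eq_norm_sq,
    real_inner_self_eq_norm_sq]

/-- `toL2` as a continuous linear map. -/
noncomputable def toL2CLM (a b : ℝ) : H10 a b →L[ℝ] L2 a b :=
  (WithLp.fstL 2 ℝ (L2 a b) (L2 a b)).comp (H10 a b).subtypeL

/-- `grad` as a continuous linear map. -/
noncomputable def gradCLM (a b : ℝ) : H10 a b →L[ℝ] L2 a b :=
  (WithLp.sndL 2 ℝ (L2 a b) (L2 a b)).comp (H10 a b).subtypeL

@[simp] theorem toL2CLM_apply (v : H10 a b) : toL2CLM a b v = toL2 v := rfl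

@[simp] theorem gradCLM_apply (v : H10 a b) : gradCLM a b v = grad v := rfl

/-- The zero function has only the zero weak derivative, so the second component of the pair is
determined by the first. -/
theorem toL2_injective : Function.Injective (toL2 : H10 a b → L2 a b) := by
  rw [show (toL2 : H10 a b → L2 a b) = toL2CLM a b from rfl, injective_iff_map_eq_zero]
  intro v hv
  rw [toL2CLM_apply] at hv
  have hw : IsWeakDeriv a b (toL2 v) (grad v) := v.2.1
  have hg : grad v = 0 := by
    refine (Lp.eq_zero_iff_ae_eq_zero).2
      (ae_eq_zero_of_forall_isTestFunction (integrable_L2 _) fun φ hφ => ?_)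
    have h1 := hw φ hφ
    have h2 : ∫ x in Ioo a b, deriv φ x • toL2 v x = 0 := by
      refine integral_eq_zero_of_ae ?_
      rw [hv]
      filter_upwards [Lp.coeFn_zero ℝ 2 (volume.restrict (Ioo a b))] with x hx
      rw [hx]
      simp
    linarith
  have h : ‖v‖ ^ 2 = 0 := by rw [norm_sq_H10, hv, hg]; simp
  simpa using h

/-- The Sobolev embedding of `H_0^1` into the bounded functions. -/
theorem exists_forall_ae_abs_toL2_le (hab : a < b) :
    ∃ K : ℝ, 0 ≤ K ∧ ∀ v : H10 a b, ∀ᵐ x ∂(volume.restrict (Ioo a b)),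
      |toL2 v x| ≤ K * ‖grad v‖ := by
  have hm : MemLp (fun _ : ℝ => (1 : ℝ)) 2 (volume.restrict (Ioo a b)) := memLp_const 1
  -- The constant is the `L²` norm of the function `1`: Cauchy–Schwarz bounds `∫ |∇v|`, which in
  -- turn bounds the primitive `v`.
  refine ⟨‖hm.toLp _‖, norm_nonneg _, fun v => ?_⟩
  have h1 : ∫ x in Ioo a b, |grad v x| ≤ ‖hm.toLp _‖ * ‖grad v‖ := by
    calc ∫ x in Ioo a b, |grad v x| = inner ℝ (hm.toLp _) |grad v| := by
          rw [L2.inner_def]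
          refine integral_congr_ae ?_
          filter_upwards [hm.coeFn_toLp, Lp.coeFn_abs (grad v)] with x hx hx'
          rw [hx, hx']
          simp
      _ ≤ ‖hm.toLp _‖ * ‖|grad v|‖ := real_inner_le_norm _ _
      _ = ‖hm.toLp _‖ * ‖grad v‖ := by rw [norm_abs_eq_norm]
  filter_upwards [toL2_ae_eq_primitive hab v, ae_restrict_mem measurableSet_Ioo] with x hx hxm
  rw [hx]
  refine le_trans ?_ h1
  rw [← Real.norm_eq_abs]
  refine (intervalIntegral.norm_integral_le_integral_norm hxm.1.le).trans ?_
  rw [intervalIntegral.integral_of_le hxm.1.le]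
  refine setIntegral_mono_set (integrable_L2 _).norm (ae_of_all _ fun _ => norm_nonneg _) ?_
  exact (Ioc_subset_Ioo_right hxm.2).eventuallyLE

theorem AbsolutelyContinuousOnInterval.lipschitz_comp {f P : ℝ → ℝ} {K : NNReal}
    (hP : LipschitzWith K P) (hf : AbsolutelyContinuousOnInterval f a b) :
    AbsolutelyContinuousOnInterval (fun x => P (f x)) a b := by
  rw [absolutelyContinuousOnInterval_iff] at hf ⊢
  intro ε hε
  -- `K + 1` instead of `K` covers the case `K = 0`.
  obtain ⟨δ, hδ, h⟩ := hf (ε / (K + 1)) (by positivity)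
  refine ⟨δ, hδ, fun E hE hE' => ?_⟩
  have h1 := h E hE hE'
  calc ∑ i ∈ Finset.range E.1, dist (P (f (E.2 i).1)) (P (f (E.2 i).2))
      ≤ ∑ i ∈ Finset.range E.1, (K : ℝ) * dist (f (E.2 i).1) (f (E.2 i).2) :=
        Finset.sum_le_sum fun i _ => hP.dist_le_mul _ _
    _ = K * ∑ i ∈ Finset.range E.1, dist (f (E.2 i).1) (f (E.2 i).2) := by rw [Finset.mul_sum]
    _ ≤ (K + 1) * ∑ i ∈ Finset.range E.1, dist (f (E.2 i).1) (f (E.2 i).2) := by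
        gcongr
        simp
    _ < (K + 1) * (ε / (K + 1)) := by gcongr
    _ = ε := by field_simp

/-- The convection term of a conservation law does not contribute to the energy balance. -/
theorem integral_comp_mul_grad_eq_zero (hab : a < b) {F : ℝ → ℝ} (hF : Continuous F) {C : ℝ}
    (hC : ∀ s, |F s| ≤ C) (v : H10 a b) :
    ∫ x in Ioo a b, F (toL2 v x) * grad v x = 0 := by
  have hg := intervalIntegrable_L2 hab.le (grad v)
  -- With `P` an antiderivative of `F`, the integrand is the derivative of `P ∘ v`. The bound on `F`
  -- makes `P` Lipschitz, so `P ∘ v` is absolutely continuous and the integral equals `P 0 - P 0`.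
  have hP : ∀ s, HasDerivAt (fun s => ∫ r in (0 : ℝ)..s, F r) (F s) s := fun s =>
    intervalIntegral.integral_hasDerivAt_right (hF.intervalIntegrable _ _)
      (hF.stronglyMeasurableAtFilter _ _) hF.continuousAt
  have hC0 : 0 ≤ C := (abs_nonneg _).trans (hC 0)
  have hPL : LipschitzWith ⟨C, hC0⟩ fun s => ∫ r in (0 : ℝ)..s, F r :=
    lipschitzWith_of_nnnorm_deriv_le (fun s => (hP s).differentiableAt)
      fun s => by rw [(hP s).deriv]; exact hC s
  have hac : AbsolutelyContinuousOnInterval (fun x => ∫ t in a..x, grad v t) a b :=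
    hg.absolutelyContinuousOnInterval_intervalIntegral left_mem_uIcc
  have h := (AbsolutelyContinuousOnInterval.lipschitz_comp hPL hac).integral_deriv_eq_sub
  simp only [integral_grad_eq_zero hab v, intervalIntegral.integral_same, sub_self] at h
  have h1 : ∫ x in Ioo a b, F (toL2 v x) * grad v x
      = ∫ x in Ioo a b, F (∫ t in a..x, grad v t) * grad v x := by
    refine integral_congr_ae ?_
    filter_upwards [toL2_ae_eq_primitive hab v] with x hx
    rw [hx]
  rw [h1, setIntegral_Ioo_eq_intervalIntegral hab.le, ← h]
  refine intervalIntegral.integral_congr_ae ?_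
  filter_upwards [hg.ae_hasDerivAt_integral] with x hx hxm
  exact ((hP _).comp x (hx (uIoc_subset_uIcc hxm) a left_mem_uIcc)).deriv.symm

end Sobolev

/-! ### The equation as a vector field on `H10` -/

section Field

variable {a b : ℝ}

/-- The flux cut off at height `M`. -/
noncomputable def truncatedFlux (p : ℕ) (M s : ℝ) : ℝ := flux p (max (-M) (min M s))

theorem truncatedFlux_of_abs_le {p : ℕ} {M s : ℝ} (h : |s| ≤ M) :
    truncatedFlux p M s = flux p s := by
  rw [truncatedFlux, min_eq_right (abs_le.1 h).2, max_eq_right (abs_le.1 h).1]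

theorem truncatedFlux_zero {p : ℕ} {M : ℝ} (hM : 0 ≤ M) : truncatedFlux p M 0 = 0 := by
  rw [truncatedFlux_of_abs_le (by simpa)]
  simp [flux]

theorem contDiff_flux (p : ℕ) : ContDiff ℝ 1 (flux p) := by
  unfold flux
  fun_prop

theorem exists_lipschitzWith_truncatedFlux (p : ℕ) {M : ℝ} (hM : 0 ≤ M) :
    ∃ K, LipschitzWith K (truncatedFlux p M) := by
  obtain ⟨K, hK⟩ := LocallyLipschitzOn.exists_lipschitzOnWith_of_compact
    (isCompact_Icc (a := -M) (b := M)) (contDiff_flux p).locallyLipschitz.locallyLipschitzOn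
  have h1 : LipschitzWith 1 fun s : ℝ => max (-M) (min M s) :=
    (LipschitzWith.id.const_min M).const_max (-M)
  have h2 : ∀ s : ℝ, max (-M) (min M s) ∈ Icc (-M) M := fun s =>
    ⟨le_max_left _ _, max_le (by linarith) (min_le_left _ _)⟩
  refine ⟨K * 1, lipschitzOnWith_univ.1 ?_⟩
  exact hK.comp h1.lipschitzOnWith fun s _ => h2 s

theorem exists_abs_truncatedFlux_le (p : ℕ) {M : ℝ} (hM : 0 ≤ M) :
    ∃ C, ∀ s, |truncatedFlux p M s| ≤ C := by
  obtain ⟨C, hC⟩ := (isCompact_Icc (a := -M) (b := M)).exists_bound_of_continuousOn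
    (contDiff_flux p).continuous.continuousOn
  exact ⟨C, fun s => hC _ ⟨le_max_left _ _, max_le (by linarith) (min_le_left _ _)⟩⟩

/-- The inner product `(v, w) + μ (∇v, ∇w)` on `H_0^1`. -/
noncomputable def energyForm (a b μ : ℝ) : H10 a b →L[ℝ] H10 a b →L[ℝ] ℝ :=
  (isBoundedBilinearMap_inner (𝕜 := ℝ)).toContinuousLinearMap.bilinearComp
      (toL2CLM a b) (toL2CLM a b) +
    μ • (isBoundedBilinearMap_inner (𝕜 := ℝ)).toContinuousLinearMap.bilinearComp
      (gradCLM a b) (gradCLM a b)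

theorem energyForm_apply (μ : ℝ) (v w : H10 a b) :
    energyForm a b μ v w = inner ℝ (toL2 v) (toL2 w) + μ * inner ℝ (grad v) (grad w) := rfl

theorem min_mul_norm_sq_le_energyForm (μ : ℝ) (v : H10 a b) :
    min 1 μ * ‖v‖ ^ 2 ≤ energyForm a b μ v v := by
  rw [energyForm_apply, real_inner_self_eq_norm_sq, real_inner_self_eq_norm_sq, norm_sq_H10]
  nlinarith [sq_nonneg ‖toL2 v‖, sq_nonneg ‖grad v‖, min_le_left 1 μ, min_le_right 1 μ]

theorem isCoercive_energyForm {μ : ℝ} (hμ : 0 < μ) : IsCoercive (energyForm a b μ) :=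
  ⟨min 1 μ, lt_min one_pos hμ, fun v => by
    rw [mul_assoc, ← sq]
    exact min_mul_norm_sq_le_energyForm μ v⟩

/-- By coercivity `v - w`, paired with itself, has zero norm. This makes `u_t` the only solution of
the weak equation at a given time. -/
theorem ext_energyForm {μ : ℝ} (hμ : 0 < μ) {v w : H10 a b}
    (h : ∀ ξ, energyForm a b μ v ξ = energyForm a b μ w ξ) : v = w := by
  have h1 := min_mul_norm_sq_le_energyForm μ (v - w)
  rw [map_sub (energyForm a b μ), sub_apply, h, sub_self] at h1
  have h2 : ‖v - w‖ ^ 2 ≤ 0 := nonpos_of_mul_nonpos_right h1 (lt_min one_pos hμ)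
  rw [← sub_eq_zero, ← norm_eq_zero]
  exact pow_eq_zero_iff two_ne_zero |>.1 (le_antisymm h2 (sq_nonneg _))

/-- The weak problem with a bounded Lipschitz nonlinearity is governed by a bounded Lipschitz
vector field on `H_0^1`. -/
theorem exists_field (hab : a < b) {μ : ℝ} (hμ : 0 < μ) {F : ℝ → ℝ} {K : NNReal}
    (hF : LipschitzWith K F) (h0 : F 0 = 0) {C : ℝ} (hC : ∀ s, |F s| ≤ C) :
    ∃ (G : H10 a b → H10 a b) (K' L : NNReal), LipschitzWith K' G ∧ (∀ v, ‖G v‖ ≤ L) ∧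
      ∀ v ξ, energyForm a b μ (G v) ξ = -∫ x in Ioo a b, F (toL2 v x) * grad ξ x := by
  have := completeSpace_H10 hab
  let A := (isCoercive_energyForm (a := a) (b := b) hμ).continuousLinearEquivOfBilin
  -- The adjoint of the gradient represents `ξ ↦ (f, ∇ξ)` in the `H¹` inner product; `A.symm`
  -- converts this into a representation by the energy form.
  let S : L2 a b →L[ℝ] H10 a b :=
    (A.symm : H10 a b →L[ℝ] H10 a b).comp (ContinuousLinearMap.adjoint (gradCLM a b))
  have hS : ∀ f ξ, energyForm a b μ (S f) ξ = inner ℝ f (grad ξ) := fun f ξ => by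
    rw [← IsCoercive.continuousLinearEquivOfBilin_apply (isCoercive_energyForm hμ)]
    change inner ℝ (A (A.symm (ContinuousLinearMap.adjoint (gradCLM a b) f))) ξ = _
    rw [A.apply_symm_apply, ContinuousLinearMap.adjoint_inner_left, gradCLM_apply]
  have hC0 : 0 ≤ C := (abs_nonneg _).trans (hC 0)
  have hN : ∀ f : L2 a b, ‖hF.compLp h0 f‖
      ≤ measureUnivNNReal (volume.restrict (Ioo a b)) ^ (2 : ℝ≥0∞).toReal⁻¹ * C := fun f => by
    refine Lp.norm_le_of_ae_bound hC0 ?_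
    filter_upwards [hF.coeFn_compLp h0 f] with x hx
    rw [hx]
    exact hC _
  refine ⟨fun v => -S (hF.compLp h0 (toL2CLM a b v)), _,
    ⟨‖S‖ * (measureUnivNNReal (volume.restrict (Ioo a b)) ^ (2 : ℝ≥0∞).toReal⁻¹ * C),
      by positivity⟩,
    (S.lipschitz.comp ((hF.lipschitzWith_compLp h0).comp (toL2CLM a b).lipschitz)).neg,
    fun v => ?_, fun v ξ => ?_⟩
  · rw [norm_neg]
    exact (S.le_opNorm _).trans (mul_le_mul_of_nonneg_left (hN _) (norm_nonneg S))
  · rw [map_neg, neg_apply, hS, L2.inner_def, neg_inj]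
    refine integral_congr_ae ?_
    filter_upwards [hF.coeFn_compLp h0 (toL2CLM a b v)] with x hx
    rw [hx]
    simp [mul_comm]

/-- On every ball of `H_0^1` the generalized regularized long wave equation is governed by a
bounded Lipschitz vector field that preserves the energy. -/
theorem exists_field_flux (p : ℕ) (hab : a < b) {μ : ℝ} (hμ : 0 < μ) (R : ℝ) :
    ∃ (G : H10 a b → H10 a b) (K L : NNReal), LipschitzWith K G ∧ (∀ v, ‖G v‖ ≤ L) ∧
      (∀ v, energyForm a b μ (G v) v = 0) ∧
      ∀ v, ‖v‖ ≤ R → ∀ ξ,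
        energyForm a b μ (G v) ξ = -∫ x in Ioo a b, flux p (toL2 v x) * grad ξ x := by
  obtain ⟨k, hk0, hk⟩ := exists_forall_ae_abs_toL2_le hab
  -- On the ball of radius `R` the embedding gives `|v| ≤ k |R|` almost everywhere, so a cutoff at
  -- this height is inactive there. The absolute value admits negative `R`.
  have hM : 0 ≤ k * |R| := by positivity
  obtain ⟨K, hK⟩ := exists_lipschitzWith_truncatedFlux p hM
  obtain ⟨C, hC⟩ := exists_abs_truncatedFlux_le p hM
  obtain ⟨G, K', L, hG, hL, h⟩ := exists_field hab hμ hK (truncatedFlux_zero hM) hC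
  refine ⟨G, K', L, hG, hL, fun v => ?_, fun v hv ξ => ?_⟩
  · rw [h, integral_comp_mul_grad_eq_zero hab hK.continuous hC, neg_zero]
  · rw [h, neg_inj]
    refine integral_congr_ae ?_
    filter_upwards [hk v] with x hx
    have hgv : ‖grad v‖ ≤ ‖v‖ :=
      (sq_le_sq₀ (norm_nonneg _) (norm_nonneg _)).1
        (by rw [norm_sq_H10]; linarith [sq_nonneg ‖toL2 v‖])
    rw [truncatedFlux_of_abs_le (hx.trans (by gcongr; exact hgv.trans (hv.trans (le_abs_self R))))]

end Field

/-! ### Integral curves, existence and uniqueness -/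

section Evolution

/-- Bounded Lipschitz vector fields have global integral curves. -/
theorem exists_forall_hasDerivWithinAt {E : Type*} [NormedAddCommGroup E] [NormedSpace ℝ E]
    [CompleteSpace E] {G : E → E} {K L : NNReal} (hG : LipschitzWith K G) (hL : ∀ x, ‖G x‖ ≤ L)
    (x₀ : E) {T : ℝ} (hT : 0 ≤ T) :
    ∃ w : ℝ → E, w 0 = x₀ ∧ ∀ t ∈ Icc 0 T, HasDerivWithinAt w (G (w t)) (Icc 0 T) t := by
  -- A curve of speed at most `L` stays within `L * T` of `x₀` up to time `T`. The bounds on `G`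
  -- hold on every ball, so this radius imposes no restriction on `T`.
  have h : IsPicardLindelof (fun _ => G) (⟨0, left_mem_Icc.2 hT⟩ : Icc 0 T) x₀
      (L * T.toNNReal) 0 L K :=
    { lipschitzOnWith := fun _ _ => hG.lipschitzOnWith
      continuousOn := fun _ _ => continuousOn_const
      norm_le := fun _ _ x _ => hL x
      mul_max_le := by simp [hT] }
  exact h.exists_eq_forall_mem_Icc_hasDerivWithinAt₀

theorem eq_add_integral_of_hasDerivWithinAt {E : Type*} [NormedAddCommGroup E] [NormedSpace ℝ E]
    [CompleteSpace E] {G : E → E} (hG : Continuous G) {w : ℝ → E} {T : ℝ}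
    (hw : ∀ t ∈ Icc 0 T, HasDerivWithinAt w (G (w t)) (Icc 0 T) t) :
    ∀ t ∈ Icc 0 T, w t = w 0 + ∫ s in (0 : ℝ)..t, G (w s) := by
  intro t ht
  have hs : uIcc 0 t ⊆ Icc 0 T := by
    rw [uIcc_of_le ht.1]
    exact Icc_subset_Icc_right ht.2
  exact (ODE.picard_eq_of_hasDerivAt (f := fun _ => G) (u := univ)
    (hG.comp continuous_snd).continuousOn (fun s hst => (hw s (hs hst)).mono hs)
    (mapsTo_univ _ _)).symm

/-- A symmetric form is constant along the integral curves of a vector field orthogonal to the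
position. -/
theorem bilin_self_eq_of_hasDerivWithinAt {E : Type*} [NormedAddCommGroup E] [NormedSpace ℝ E]
    {B : E →L[ℝ] E →L[ℝ] ℝ} (hB : ∀ v z, B v z = B z v) {G : E → E} (hE : ∀ v, B (G v) v = 0)
    {w : ℝ → E} {T : ℝ} (hw : ∀ t ∈ Icc 0 T, HasDerivWithinAt w (G (w t)) (Icc 0 T) t) :
    ∀ t ∈ Icc 0 T, B (w t) (w t) = B (w 0) (w 0) := by
  have hd : ∀ t ∈ Icc 0 T, HasDerivWithinAt (fun t => B (w t) (w t)) 0 (Icc 0 T) t :=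
    fun t ht => by
      have h1 := (B.hasFDerivAt.comp_hasDerivWithinAt t (hw t ht)).clm_apply (hw t ht)
      refine h1.congr_deriv ?_
      rw [hE, Function.comp_apply, hB, hE, add_zero]
  exact constant_of_has_deriv_right_zero (fun t ht => (hd t ht).continuousWithinAt)
    fun t ht => ((hd t (Ico_subset_Icc_self ht)).mono
      (Icc_subset_Icc_left ht.1)).mono_of_mem_nhdsWithin (Icc_mem_nhdsGE ht.2)

variable {p : ℕ} {μ a b T : ℝ} {u₀ : H10 a b}

/-- Integral curves of energy preserving vector fields stay bounded. -/
theorem norm_le_of_energyForm_eq_zero (hμ : 0 < μ) {G : H10 a b → H10 a b}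
    (hE : ∀ v, energyForm a b μ (G v) v = 0) {w : ℝ → H10 a b}
    (hw : ∀ t ∈ Icc 0 T, HasDerivWithinAt w (G (w t)) (Icc 0 T) t) :
    ∀ t ∈ Icc 0 T, ‖w t‖ ≤ √(energyForm a b μ (w 0) (w 0) / min 1 μ) := by
  intro t ht
  have hm : 0 < min 1 μ := lt_min one_pos hμ
  have hconst := bilin_self_eq_of_hasDerivWithinAt (B := energyForm a b μ)
    (fun v z => by simp only [energyForm_apply, real_inner_comm]) hE hw t ht
  refine Real.le_sqrt_of_sq_le ?_
  rw [le_div_iff₀ hm, ← hconst, mul_comm]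
  exact min_mul_norm_sq_le_energyForm μ (w t)

/-- The radius comes from the energy of `u₀` before the curve is known. Conservation keeps the curve
of the cut-off field inside that ball, where it solves the original problem. -/
theorem exists_isWeakSolution (p : ℕ) (hμ : 0 < μ) (hab : a < b) (u₀ : H10 a b) (hT : 0 < T) :
    ∃ u, IsWeakSolution p μ a b T u₀ u := by
  have := completeSpace_H10 hab
  have : SecondCountableTopologyEither ℝ (H10 a b) := secondCountableTopologyEither_of_left _ _
  obtain ⟨G, K, L, hG, hL, hE, hR⟩ := exists_field_flux p hab hμ
    √(energyForm a b μ u₀ u₀ / min 1 μ)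
  obtain ⟨w, rfl, hw⟩ := exists_forall_hasDerivWithinAt hG hL u₀ hT.le
  have hbd := norm_le_of_energyForm_eq_zero hμ hE hw
  have hwc : ContinuousOn w (Icc 0 T) := fun t ht => (hw t ht).continuousWithinAt
  have hsub : Ioo 0 T ⊆ Icc 0 T := Ioo_subset_Icc_self
  have hmem : MemLp w ∞ (volume.restrict (Ioo 0 T)) := by
    refine memLp_top_of_bound ((hwc.mono hsub).aestronglyMeasurable measurableSet_Ioo)
      √(energyForm a b μ (w 0) (w 0) / min 1 μ) ?_
    filter_upwards [ae_restrict_mem measurableSet_Ioo] with t ht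
    exact hbd t (hsub ht)
  have hint : Integrable (fun t => G (w t)) (volume.restrict (Ioo 0 T)) :=
    (hG.continuous.comp_continuousOn hwc).integrableOn_Icc.mono_set hsub
  refine ⟨hmem.toLp w, ⟨fun t => G (w t), hint, fun φ hφ => ?_, ?_⟩,
    w, hwc, hmem.coeFn_toLp, fun _ => rfl⟩
  · rw [← isWeakDeriv_primitive hT.le hint (w 0) φ hφ]
    refine integral_congr_ae ?_
    filter_upwards [hmem.coeFn_toLp, ae_restrict_mem measurableSet_Ioo] with t ht htm
    rw [ht, eq_add_integral_of_hasDerivWithinAt hG.continuous hw t (hsub htm)]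
  · filter_upwards [hmem.coeFn_toLp, ae_restrict_mem measurableSet_Ioo] with t ht htm ξ
    rw [ht]
    exact hR _ (hbd t (hsub htm)) ξ

/-- The continuous representative of a weak solution is an integral curve of every continuous
vector field that realises the weak problem on a ball containing it. -/
theorem IsWeakSolution.exists_representative {u : LinftyH10 a b T}
    (hu : IsWeakSolution p μ a b T u₀ u) (hμ : 0 < μ) (hab : a < b) (hT : 0 < T) :
    ∃ w : ℝ → H10 a b, ContinuousOn w (Icc 0 T) ∧ u =ᵐ[volume.restrict (Ioo 0 T)] w ∧ w 0 = u₀ ∧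
      ∃ R₀, ∀ R, R₀ ≤ R → ∀ G : H10 a b → H10 a b, Continuous G →
        (∀ v, ‖v‖ ≤ R → ∀ ξ,
          energyForm a b μ (G v) ξ = -∫ x in Ioo a b, flux p (toL2 v x) * grad ξ x) →
        ∀ t ∈ Icc 0 T, HasDerivWithinAt w (G (w t)) (Icc 0 T) t := by
  have := completeSpace_H10 hab
  obtain ⟨⟨ut, hut, hd, heq⟩, w, hwc, huw, hw0⟩ := hu
  -- Continuity on the compact interval already bounds the representative; no energy estimate is
  -- needed here.
  obtain ⟨R₀, hR₀⟩ := isCompact_Icc.exists_bound_of_continuousOn hwc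
  refine ⟨w, hwc, huw, toL2_injective ?_, R₀,
    fun R hR G hG h => ?_⟩
  -- Testing the initial condition with the difference itself makes its `L²` norm vanish.
  · have h := hw0 (w 0 - u₀)
    rw [← sub_eq_zero, ← inner_sub_left, ← toL2CLM_apply, ← toL2CLM_apply, ← toL2CLM_apply,
      map_sub] at h
    exact sub_eq_zero.1 (inner_self_eq_zero.1 h)
  obtain ⟨C, hC⟩ := hd.exists_ae_eq_add_primitive hT ((Lp.memLp u).integrable le_top) hut
  have hGw : ContinuousOn (fun t => G (w t)) (Icc 0 T) := hG.comp_continuousOn hwc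
  have hutG : ut =ᵐ[volume.restrict (Ioo 0 T)] fun t => G (w t) := by
    filter_upwards [heq, huw, ae_restrict_mem measurableSet_Ioo] with t h1 h2 htm
    refine ext_energyForm hμ fun ξ => ?_
    rw [h _ ((hR₀ t (Ioo_subset_Icc_self htm)).trans hR), ← h2]
    exact h1 ξ
  have hprim : ∀ t ∈ Icc 0 T, ∫ s in (0 : ℝ)..t, ut s = ∫ s in (0 : ℝ)..t, G (w s) :=
    fun t ht => by
      rw [← setIntegral_Ioo_eq_intervalIntegral ht.1, ← setIntegral_Ioo_eq_intervalIntegral ht.1]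
      exact integral_congr_ae (ae_restrict_of_ae_restrict_of_subset (Ioo_subset_Ioo_right ht.2) hutG)
  have hpc : ContinuousOn (fun t => C + ∫ s in (0 : ℝ)..t, G (w s)) (Icc 0 T) := by
    rw [← uIcc_of_le hT.le] at hGw ⊢
    exact continuousOn_const.add (intervalIntegral.continuousOn_primitive_interval'
      hGw.intervalIntegrable left_mem_uIcc)
  have hae : w =ᵐ[volume.restrict (Icc 0 T)] fun t => C + ∫ s in (0 : ℝ)..t, G (w s) := by
    rw [← restrict_Ioo_eq_restrict_Icc]
    filter_upwards [huw, hC, ae_restrict_mem measurableSet_Ioo] with t h1 h2 htm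
    rw [← h1, h2, hprim t (Ioo_subset_Icc_self htm)]
  have hweq := Measure.eqOn_Icc_of_ae_eq volume hT.ne hae hwc hpc
  intro t ht
  -- The integrand `G (w s)` is continuous, so the integral equation upgrades to a derivative at
  -- every time, endpoints included.
  exact (ODE.hasDerivWithinAt_picard_Icc (f := fun _ => G) (u := univ) (left_mem_Icc.2 hT.le)
    (hG.comp continuous_snd).continuousOn hwc (fun _ _ => mem_univ _) C ht).congr_of_mem
    hweq ht

/-- A ball containing both continuous representatives gives one Lipschitz field of which both are
integral curves from `u₀`. -/
theorem IsWeakSolution.unique {u v : LinftyH10 a b T} (hu : IsWeakSolution p μ a b T u₀ u)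
    (hv : IsWeakSolution p μ a b T u₀ v) (hμ : 0 < μ) (hab : a < b) (hT : 0 < T) : u = v := by
  obtain ⟨w, hwc, huw, hw0, R₁, hw⟩ := hu.exists_representative hμ hab hT
  obtain ⟨z, hzc, hvz, hz0, R₂, hz⟩ := hv.exists_representative hμ hab hT
  obtain ⟨G, K, L, hG, -, -, hR⟩ := exists_field_flux p hab hμ (max R₁ R₂)
  have hr : ∀ y : ℝ → H10 a b, (∀ t ∈ Icc 0 T, HasDerivWithinAt y (G (y t)) (Icc 0 T) t) →
      ∀ t ∈ Ico 0 T, HasDerivWithinAt y (G (y t)) (Ici t) t := fun y hy t ht =>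
    ((hy t (Ico_subset_Icc_self ht)).mono (Icc_subset_Icc_left ht.1)).mono_of_mem_nhdsWithin
      (Icc_mem_nhdsGE ht.2)
  have heq := ODE_solution_unique_of_mem_Icc_right (v := fun _ => G) (s := fun _ => univ)
    (fun _ _ => hG.lipschitzOnWith) hwc
    (hr w (hw _ (le_max_left _ _) G hG.continuous hR)) (fun _ _ => mem_univ _) hzc
    (hr z (hz _ (le_max_right _ _) G hG.continuous hR)) (fun _ _ => mem_univ _)
    (hw0.trans hz0.symm)
  refine Lp.ext ?_
  filter_upwards [huw, hvz, ae_restrict_mem measurableSet_Ioo] with t h1 h2 htm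
  rw [h1, h2, heq (Ioo_subset_Icc_self htm)]

end Evolution

end GRLW

theorem mainTheorem2 (p : ℕ) (hp : 1 ≤ p) (μ : ℝ) (hμ : 0 < μ) (a b : ℝ) (hab : a < b)
    (u₀ : GRLW.H10 a b) (T : ℝ) (hT : 0 < T) :
    ∃! u : GRLW.LinftyH10 a b T, GRLW.IsWeakSolution p μ a b T u₀ u := by
  obtain ⟨u, hu⟩ := GRLW.exists_isWeakSolution p hμ hab u₀ hT
  exact ⟨u, hu, fun v hv => hv.unique hu hμ hab hT⟩
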